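/- Let $R$ be a complete discrete valuation ring with field of fractions $K$, let $F$ be a finite-dimensional skew field over $K$, let $O$ be the maximal $R$-order in $F$, let $I$ be the Jacobson radical of $O$, and let $w \in I$ be an element with $I = wO = Ow$. Let $r \ge 1$, let $\vec p = (p_1,\dots,p_r)$ be a vector of positive integers and put $p = p_1 + \dots + p_r$. Let $H = H(O,\vec p) \subset M_p(F)$ be the standard hereditary order: the ring of all $p \times p$ matrices, divided into blocks of sizes $p_i \times p_j$ $(1 \le i, j \le r)$, whose entries in the blocks with $i \ge j$ lie in $O$ and whose entries in the blocks with $i < j$ lie in $I$. Let $t \ge 1$ be the smallest divisor of $r$ such that $\vec p = (p_1,\dots,p_t;\, p_1,\dots,p_t;\, \dots;\, p_1,\dots,p_t)$, put $l = r/t$ and $q = p_1 + \dots + p_t$, so that $p = lq$, and let $$ \varrho = \begin{pmatrix} 0 & 0 & \dots & 0 & w\mathbf{1}_q \\ \mathbf{1}_q & 0 & \dots & 0 & 0 \\ 0 & \mathbf{1}_q & \dots & 0 & 0 \\ \vdots & \vdots & \ddots & \vdots & \vdots \\ 0 & 0 & \dots & \mathbf{1}_q & 0 \end{pmatrix} \in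 M_p(F) $$ ($l \times l$ blocks of size $q \times q$; for $l = 1$ this means $\varrho = w\mathbf{1}_p$). Let $N_H = \{x \in \mathrm{GL}_p(F) \mid xHx^{-1} = H\}$, and call $x, x' \in N_H$ equivalent if $x' = gxh$ for some units $g, h \in H^\ast$. Then for every $x \in N_H$ there exist $d \in \mathbb{Z}$ and an integer $k$ with $0 \le k < l$ such that $w^{-d}\varrho^k \in N_H$ and $x$ is equivalent to $w^{-d}\varrho^k$. -/

import Mathlib

namespace HereditaryOrder

section Orders

variable (R K : Type*) [CommRing R] [Field K] [Algebra R K]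
variable {A : Type*} [Ring A] [Algebra R A] [Algebra K A]

/-- `O` is an `R`-order in the `K`-algebra `A`: a subring containing `R`, finitely generated
as an `R`-module, and spanning `A` over `K`. -/
structure IsOrderIn (O : Subalgebra R A) : Prop where
  fg : (Subalgebra.toSubmodule O).FG
  span_eq_top : Submodule.span K (O : Set A) = ⊤

/-- `O` is maximal with respect to inclusion among the `R`-orders in `A`. -/
def IsMaximalOrderIn (O : Subalgebra R A) : Prop :=
  Maximal (IsOrderIn R K) O

end Orders

section Radical

variable {R A : Type*} [CommRing R] [Ring A] [Algebra R A]

/-- The Jacobson radical of the subring `O`, regarded as a subset of the ambient algebra `A`. -/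
def rad (O : Subalgebra R A) : Submodule R A :=
  ((Ring.jacobson O).restrictScalars R).map O.val.toLinearMap

/-- `w` generates the Jacobson radical `I` of `O` on both sides: `I = w O = O w`. -/
def IsRadGenerator (O : Subalgebra R A) (w : A) : Prop :=
  (rad O : Set A) = {y | ∃ a ∈ O, y = w * a} ∧ (rad O : Set A) = {y | ∃ a ∈ O, y = a * w}

theorem mem_of_mem_rad {O : Subalgebra R A} {y : A} (h : y ∈ rad O) : y ∈ O := by
  obtain ⟨z, _, rfl⟩ := h
  exact z.2

theorem mul_mem_rad_left {O : Subalgebra R A} {x y : A} (hx : x ∈ O) (hy : y ∈ rad O) :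
    x * y ∈ rad O := by
  obtain ⟨z, hz, rfl⟩ := hy
  exact ⟨⟨x, hx⟩ * z, (Ring.jacobson O).mul_mem_left _ hz, rfl⟩

theorem mul_mem_rad_right {O : Subalgebra R A} {x y : A} (hx : x ∈ rad O) (hy : y ∈ O) :
    x * y ∈ rad O := by
  obtain ⟨z, hz, rfl⟩ := hx
  exact ⟨z * ⟨y, hy⟩, (Ring.jacobson O).mul_mem_right _ hz, rfl⟩

end Radical

section Standard

variable {r : ℕ}

/-- The block containing the position `a`, when the `p₁ + ⋯ + pᵣ` positions are cut into
consecutive blocks of sizes `p₁, …, pᵣ`. -/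
def block (p : Fin r → ℕ) (a : Fin (∑ i, p i)) : Fin r :=
  (finSigmaFinEquiv.symm a).1

variable {R F : Type*} [CommRing R] [Ring F] [Algebra R F]

/-- The standard order `H(O, p)`: matrices with all entries in `O`, and with entries in the
radical `I` of `O` strictly above the diagonal blocks. -/
def standardOrder (O : Subalgebra R F) (p : Fin r → ℕ) :
    Subalgebra R (Matrix (Fin (∑ i, p i)) (Fin (∑ i, p i)) F) where
  carrier := {x | (∀ a b, x a b ∈ O) ∧ ∀ a b, block p a < block p b → x a b ∈ rad O}
  mul_mem' := by
    rintro x y ⟨hx, hx'⟩ ⟨hy, hy'⟩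
    refine ⟨fun a b => ?_, fun a b hab => ?_⟩
    · rw [Matrix.mul_apply]
      exact sum_mem fun c _ => mul_mem (hx a c) (hy c b)
    · rw [Matrix.mul_apply]
      refine sum_mem fun c _ => ?_
      rcases lt_or_ge (block p a) (block p c) with h | h
      · exact mul_mem_rad_right (hx' a c h) (hy c b)
      · exact mul_mem_rad_left (hx a c) (hy' c b (h.trans_lt hab))
  add_mem' := by
    rintro x y ⟨hx, hx'⟩ ⟨hy, hy'⟩
    exact ⟨fun a b => add_mem (hx a b) (hy a b),
      fun a b h => add_mem (hx' a b h) (hy' a b h)⟩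
  algebraMap_mem' := by
    intro c
    refine ⟨fun a b => ?_, fun a b h => ?_⟩
    · rw [Matrix.algebraMap_matrix_apply]
      split_ifs
      · exact O.algebraMap_mem c
      · exact zero_mem _
    · have hne : a ≠ b := by
        rintro rfl
        exact lt_irrefl _ h
      rw [Matrix.algebraMap_matrix_apply, if_neg hne]
      exact zero_mem _

/-- `p = (p₁, …, p_t; p₁, …, p_t; …; p₁, …, p_t)`, a whole number of copies. -/
def IsPeriod (p : Fin r → ℕ) (t : ℕ) : Prop :=
  1 ≤ t ∧ t ∣ r ∧ ∀ i j : Fin r, (i : ℕ) ≡ (j : ℕ) [MOD t] → p i = p j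

/-- `q = p₁ + ⋯ + p_t`. -/
def partialSize (p : Fin r → ℕ) (t : ℕ) : ℕ :=
  ∑ i : Fin r with i.val < t, p i

/-- The `n × n` matrix which in terms of blocks of size `q` has identity blocks directly below
the diagonal, the block `w • 1` in the upper right corner, and zeros elsewhere. -/
def rotation (n q : ℕ) (w : F) : Matrix (Fin n) (Fin n) F :=
  Matrix.of fun a b =>
    if (a : ℕ) = b + q then 1 else if (a : ℕ) + n = b + q then w else 0

end Standard

section Normalizer

variable {R A : Type*} [CommRing R] [Ring A] [Algebra R A]

/-- `N_H = {x ∈ A* | x H x⁻¹ = H}`. -/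
def normalizer (H : Subalgebra R A) : Set Aˣ :=
  {x | (fun a : A => (x : A) * a * ((x⁻¹ : Aˣ) : A)) '' (H : Set A) = H}

/-- Elements `x, x'` of `N_H` are equivalent if `x' = g x h` with units `g, h` of `H`. -/
def Equivalent (H : Subalgebra R A) (x x' : normalizer H) : Prop :=
  ∃ g h : Hˣ, ((x' : Aˣ) : A) = ((g : H) : A) * ((x : Aˣ) : A) * ((h : H) : A)

end Normalizer

end HereditaryOrder

/-! An order in a division algebra over a complete discretely valued field is local, so a two-sided
generator `w` of its radical makes it a noncommutative discrete valuation ring with valuation `ν`.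
Numbering blocks from `0`, give a nonzero row vector `v` the height `min_b (r * ν (v b) - block b)`,
and let `L_j` consist of `0` and the vectors of height at least `j`. Then `H` is exactly the set of
matrices with `L_j x ⊆ L_j` for all `j` (`mem_standardOrder_iff`), and `v H = L_j` whenever `v` has
height `j`.

For `x ∈ N_H` this gives `L_j x = v H x = (v x) H`, again a member of the chain. Hence `x` induces
an order automorphism of `ℤ`, a translation by some `c` (`exists_isShift_of_mem_normalizer`).
Comparing block sizes in degrees `j` and `j + c` shows that the cyclic sequence of block sizes has
period `c`, so `t ∣ c` by minimality of `t`. The matrix `ϱ` shifts by `t` and the scalar `w` by `r =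
l * t`, so some `y = w ^ (-d) ϱ ^ k` with `0 ≤ k < l` also shifts by `c`. Then `y x⁻¹` and its
inverse shift by `0`, hence lie in `H`, and `y = (y x⁻¹) x`. -/

namespace HereditaryOrder

/-! ### Commutative domains finite over a complete local ring -/

section FiniteOverComplete

variable {R S : Type*} [CommRing R]

/-- A finite module over an adically complete ring is precomplete. -/
theorem isPrecomplete_of_finite (I : Ideal R) [IsPrecomplete I R] (M : Type*) [AddCommGroup M]
    [Module R M] [Module.Finite R M] : IsPrecomplete I M := by
  rw [← AdicCompletion.of_surjective_iff]
  intro z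
  -- For finite `M` the completion is a quotient of the completion of `R` tensored with `M`, and
  -- elements of the completion of `R` come from `R`.
  obtain ⟨y, rfl⟩ := AdicCompletion.ofTensorProduct_surjective_of_finite I M z
  induction y with
  | zero => exact ⟨0, by simp⟩
  | add a b ha hb =>
    obtain ⟨a', ha⟩ := ha
    obtain ⟨b', hb⟩ := hb
    exact ⟨a' + b', by rw [map_add, map_add, ha, hb]⟩
  | tmul c m =>
    obtain ⟨c, rfl⟩ := AdicCompletion.of_surjective I R c
    refine ⟨c • m, ?_⟩
    rw [AdicCompletion.ofTensorProduct_tmul]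
    ext n
    simp only [AdicCompletion.of_apply, AdicCompletion.smul_eval, map_smul]
    rfl

theorem isAdicComplete_map_of_finite [IsLocalRing R] [IsNoetherianRing R]
    [IsAdicComplete (IsLocalRing.maximalIdeal R) R] [CommRing S] [Algebra R S]
    [Module.Finite R S] :
    IsAdicComplete ((IsLocalRing.maximalIdeal R).map (algebraMap R S)) S := by
  have h := isPrecomplete_of_finite (IsLocalRing.maximalIdeal R) S
  have h' : IsHausdorff (IsLocalRing.maximalIdeal R) S := inferInstance
  exact { toIsHausdorff := IsHausdorff.map_algebraMap_iff.2 h'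
          toIsPrecomplete := IsPrecomplete.map_algebraMap_iff.2 h }

/-- In a domain which is finite over a complete Noetherian local ring, one of `a` and `1 - a` is
a unit. -/
theorem isUnit_or_isUnit_one_sub_of_finite [IsLocalRing R] [IsNoetherianRing R]
    [IsAdicComplete (IsLocalRing.maximalIdeal R) R] [CommRing S] [IsDomain S] [Algebra R S]
    [Module.Finite R S] (a : S) : IsUnit a ∨ IsUnit (1 - a) := by
  set J := (IsLocalRing.maximalIdeal R).map (algebraMap R S)
  have hc : IsAdicComplete J S := isAdicComplete_map_of_finite
  have hloc := isLocalHom_of_le_jacobson_bot J (IsAdicComplete.le_jacobson_bot J)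
  let _ : Field (R ⧸ IsLocalRing.maximalIdeal R) := Ideal.Quotient.field _
  have hfin : Module.Finite (R ⧸ IsLocalRing.maximalIdeal R) (S ⧸ J) :=
    Module.Finite.of_restrictScalars_finite R _ _
  have hart : IsArtinianRing (S ⧸ J) :=
    IsArtinianRing.of_finite (R ⧸ IsLocalRing.maximalIdeal R) (S ⧸ J)
  set q := Ideal.Quotient.mk J
  -- Fitting's argument: the powers of `q a` stabilize, which makes `q a ^ n * y ^ n` idempotent. It
  -- lifts to an idempotent of the domain `S`, which is `0` or `1`; accordingly `q a` is nilpotent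
  -- or a unit.
  obtain ⟨n, y, hy⟩ := IsArtinian.exists_pow_succ_smul_dvd (q a) (1 : S ⧸ J)
  simp only [smul_eq_mul, mul_one] at hy
  have hpow : ∀ k, q a ^ (n + k) * y ^ k = q a ^ n := by
    intro k
    induction k with
    | zero => simp
    | succ k ih =>
      calc q a ^ (n + (k + 1)) * y ^ (k + 1) = (q a ^ (n + 1) * y) * (q a ^ k * y ^ k) := by ring
        _ = q a ^ (n + k) * y ^ k := by rw [hy]; ring
        _ = _ := ih
  have hn := hpow n
  obtain ⟨e, he⟩ := Ideal.Quotient.mk_surjective (I := J) (q a ^ n * y ^ n)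
  have hidem : q e * q e = q e := by
    change q e = _ at he
    rw [he]
    calc _ = (q a ^ (n + n) * y ^ n) * y ^ n := by ring
      _ = _ := by rw [hn]
  obtain ⟨f, hf, hfe⟩ := HenselianRing.is_henselian (I := J)
    (Polynomial.X ^ 2 - Polynomial.X : Polynomial S)
    (by
      apply Polynomial.monic_X_pow_sub
      simp) e
    (by
      rw [← Ideal.Quotient.eq_zero_iff_mem]
      simp only [Polynomial.eval_sub, Polynomial.eval_pow, Polynomial.eval_X, map_sub, map_pow]
      rw [sub_eq_zero, pow_two]
      exact hidem)
    -- The derivative `2e - 1` is a unit modulo `J` because its square is `1 + 4(e² - e)`.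
    (by
      have hder : (Polynomial.derivative (Polynomial.X ^ 2 - Polynomial.X : Polynomial S)).eval e
          = e + e - 1 := by simp [← two_mul]
      rw [hder]
      refine IsUnit.of_mul_eq_one (q (e + e - 1)) ?_
      simp only [map_sub, map_add, map_one]
      linear_combination 4 * hidem)
  have hf' : f * (f - 1) = 0 := by
    have : f ^ 2 - f = 0 := by simpa [Polynomial.IsRoot] using hf
    linear_combination this
  have hfe' : q f = q a ^ n * y ^ n := by
    rw [← he]
    exact Ideal.Quotient.eq.2 hfe
  rcases mul_eq_zero.1 hf' with h0 | h1
  · right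
    rw [h0, map_zero] at hfe'
    have hnil : q a ^ n = 0 := by
      rw [← hn, pow_add, mul_assoc, ← hfe', mul_zero]
    refine hloc.map_nonunit _ ?_
    rw [map_sub, map_one]
    exact IsNilpotent.isUnit_one_sub ⟨n, hnil⟩
  · left
    rw [sub_eq_zero.1 h1, map_one] at hfe'
    rcases Nat.eq_zero_or_pos n with rfl | hpos
    · refine hloc.map_nonunit _ (IsUnit.of_mul_eq_one y ?_)
      simpa using hy
    · refine hloc.map_nonunit _ ?_
      have : IsUnit (q a ^ n) := IsUnit.of_mul_eq_one (y ^ n) hfe'.symm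
      exact (isUnit_pow_iff hpos.ne').1 this

end FiniteOverComplete

end HereditaryOrder

namespace HereditaryOrder

/-! ### Orders in division rings: locality, radical, denominators -/

section UnitsOfOrder

variable {R F : Type*} [CommRing R] [DivisionRing F] [Algebra R F]

/-- `u` is a unit of the subring `O` of the division ring `F`. -/
structure IsUnitOf (O : Subalgebra R F) (u : F) : Prop where
  ne_zero : u ≠ 0
  mem : u ∈ O
  inv_mem : u⁻¹ ∈ O

variable {O : Subalgebra R F}

theorem IsUnitOf.of_mul_eq_one {u v : F} (hu : u ∈ O) (hv : v ∈ O) (h : u * v = 1) :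
    IsUnitOf O u := by
  have h0 : u ≠ 0 := by
    rintro rfl
    simp at h
  exact ⟨h0, hu, by rwa [inv_eq_of_mul_eq_one_right h]⟩

theorem IsUnitOf.inv {u : F} (hu : IsUnitOf O u) : IsUnitOf O u⁻¹ :=
  ⟨inv_ne_zero hu.ne_zero, hu.inv_mem, by rw [inv_inv]; exact hu.mem⟩

theorem IsUnitOf.mul {u v : F} (hu : IsUnitOf O u) (hv : IsUnitOf O v) : IsUnitOf O (u * v) :=
  ⟨mul_ne_zero hu.ne_zero hv.ne_zero, mul_mem hu.mem hv.mem, by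
    rw [mul_inv_rev]; exact mul_mem hv.inv_mem hu.inv_mem⟩

theorem isUnitOf_one : IsUnitOf O (1 : F) :=
  ⟨one_ne_zero, one_mem _, by rw [inv_one]; exact one_mem _⟩

/-- If `O` is local, its radical consists of the elements which are not units. -/
theorem mem_rad_iff_not_isUnitOf (hloc : ∀ a ∈ O, IsUnitOf O a ∨ IsUnitOf O (1 - a)) {y : F} :
    y ∈ rad O ↔ y ∈ O ∧ ¬ IsUnitOf O y := by
  constructor
  · intro hy
    refine ⟨mem_of_mem_rad hy, fun hu => ?_⟩
    have h1 := mul_mem_rad_left hu.inv_mem hy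
    rw [inv_mul_cancel₀ hu.ne_zero] at h1
    obtain ⟨z, hz, hz1⟩ := h1
    have : z = 1 := Subtype.ext hz1
    subst this
    exact (Ring.jacobson_lt_top O).ne ((Ideal.eq_top_iff_one _).2 hz)
  · rintro ⟨hy, hu⟩
    refine ⟨⟨y, hy⟩, ?_, rfl⟩
    change (⟨y, hy⟩ : O) ∈ Ring.jacobson O
    rw [Ring.jacobson_eq_sInf_isMaximal, Ideal.mem_sInf]
    intro M hM
    by_contra hyM
    obtain ⟨s, m, hm, hsm⟩ := hM.exists_inv hyM
    -- Here `s * y + m = 1`. A unit `m` contradicts properness of `M`; otherwise `1 - m = s * y` is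
    -- a unit, and `(s * y)⁻¹ * s` is the inverse of `y`.
    rcases hloc m.1 m.2 with h | h
    · apply hM.ne_top
      rw [Ideal.eq_top_iff_one]
      have : (⟨_, h.inv_mem⟩ : O) * m = 1 := Subtype.ext (inv_mul_cancel₀ h.ne_zero)
      rw [← this]
      exact M.mul_mem_left _ hm
    · have h1 : (1 : F) - m.1 = s.1 * y := by
        rw [sub_eq_iff_eq_add]
        exact (congrArg Subtype.val hsm).symm
      rw [h1] at h
      have h0 : y ≠ 0 := by
        rintro rfl
        exact h.ne_zero (mul_zero _)
      have hs0 : s.1 ≠ 0 := by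
        intro h'
        exact h.ne_zero (by rw [h', zero_mul])
      refine hu ⟨h0, hy, ?_⟩
      have := mul_mem h.inv_mem s.2
      rwa [mul_inv_rev, mul_assoc, inv_mul_cancel₀ hs0, mul_one] at this

end UnitsOfOrder

section Order

variable {R F : Type*} [CommRing R] [IsDomain R] [IsDiscreteValuationRing R]
  [DivisionRing F] [Algebra R F] {O : Subalgebra R F}

theorem isNoetherian_of_fg (hO : (Subalgebra.toSubmodule O).FG) : IsNoetherian R O :=
  have : IsNoetherian R (Subalgebra.toSubmodule O) := isNoetherian_of_fg_of_noetherian _ hO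
  this

/-- An order in a division algebra over a complete discretely valued field is local. -/
theorem isUnitOf_or_isUnitOf_one_sub [IsAdicComplete (IsLocalRing.maximalIdeal R) R]
    (hO : (Subalgebra.toSubmodule O).FG) (a : F) (ha : a ∈ O) :
    IsUnitOf O a ∨ IsUnitOf O (1 - a) := by
  -- The subring `R[a]` is a commutative domain, finite over `R` as a submodule of `O`, so the
  -- commutative case applies.
  have hle : Algebra.adjoin R {a} ≤ O := Algebra.adjoin_le (by simpa using ha)
  have hcomm : IsMulCommutative (Algebra.adjoin R {a}) :=
    Algebra.isMulCommutative_adjoin R (by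
      intro x hx y hy
      rw [Set.mem_singleton_iff.1 hx, Set.mem_singleton_iff.1 hy])
  have hdom : IsDomain (Algebra.adjoin R {a}) := inferInstance
  have hN : IsNoetherian R (Subalgebra.toSubmodule O) := isNoetherian_of_fg_of_noetherian _ hO
  have hN' : IsNoetherian R (Subalgebra.toSubmodule (Algebra.adjoin R {a})) :=
    isNoetherian_of_le (t := Subalgebra.toSubmodule O) hle
  have hfin : Module.Finite R (Algebra.adjoin R {a}) :=
    have : Module.Finite R (Subalgebra.toSubmodule (Algebra.adjoin R {a})) := inferInstance
    this
  have key : ∀ b : Algebra.adjoin R {a}, IsUnit b → IsUnitOf O (b : F) := by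
    rintro b hb
    obtain ⟨c, hc⟩ := hb.exists_right_inv
    exact IsUnitOf.of_mul_eq_one (hle b.2) (hle c.2) (congrArg Subtype.val hc)
  rcases isUnit_or_isUnit_one_sub_of_finite (R := R)
    (⟨a, Algebra.self_mem_adjoin_singleton R a⟩ : Algebra.adjoin R {a}) with h | h
  · exact Or.inl (key _ h)
  · exact Or.inr (key _ h)

/-- An order over a discrete valuation ring is not a division ring. -/
theorem exists_mem_not_isUnitOf (K : Type*) [Field K] [Algebra R K] [IsFractionRing R K]
    [Algebra K F] [IsScalarTower R K F] (hO : (Subalgebra.toSubmodule O).FG) :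
    ∃ a ∈ O, a ≠ 0 ∧ ¬ IsUnitOf O a := by
  obtain ⟨ϖ, hϖ⟩ := IsDiscreteValuationRing.exists_irreducible R
  have hinj : Function.Injective (algebraMap K F) := (algebraMap K F).injective
  have hinjR : Function.Injective (algebraMap R K) := IsFractionRing.injective R K
  refine ⟨algebraMap R F ϖ, O.algebraMap_mem ϖ, ?_, fun h => ?_⟩
  · rw [IsScalarTower.algebraMap_apply R K F]
    simpa using hϖ.ne_zero
  -- If `ϖ⁻¹` were in `O`, it would be integral over the integrally closed ring `R`, hence in `R`.
  · have hfin : Module.Finite R O := Module.Finite.iff_fg.2 hO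
    have hint : IsIntegral R (⟨_, h.inv_mem⟩ : O) := Algebra.IsIntegral.isIntegral _
    have hint' : IsIntegral R ((algebraMap R F ϖ)⁻¹) := hint.map O.val
    rw [IsScalarTower.algebraMap_apply R K F, ← map_inv₀] at hint'
    have hint'' : IsIntegral R ((algebraMap R K ϖ)⁻¹) :=
      (isIntegral_algebraMap_iff hinj).1 hint'
    obtain ⟨c, hc⟩ := IsIntegrallyClosed.isIntegral_iff.1 hint''
    apply hϖ.not_isUnit
    refine IsUnit.of_mul_eq_one c (hinjR ?_)
    rw [map_mul, hc, map_one, mul_inv_cancel₀]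
    simpa using hϖ.ne_zero

/-- Every element of the algebra has a denominator in `R` with respect to an order. -/
theorem exists_algebraMap_mul_mem {K : Type*} [Field K] [Algebra R K] [IsFractionRing R K]
    [Algebra K F] [IsScalarTower R K F] (hO : Submodule.span K (O : Set F) = ⊤) (a : F) :
    ∃ s : R, s ≠ 0 ∧ algebraMap R F s * a ∈ O := by
  have ha : a ∈ Submodule.span K (O : Set F) := hO ▸ Submodule.mem_top
  induction ha using Submodule.span_induction with
  | mem x hx => exact ⟨1, one_ne_zero, by simpa using hx⟩
  | zero => exact ⟨1, one_ne_zero, by simp⟩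
  | add x y _ _ hx hy =>
    obtain ⟨s, hs, hs'⟩ := hx
    obtain ⟨u, hu, hu'⟩ := hy
    refine ⟨s * u, mul_ne_zero hs hu, ?_⟩
    rw [mul_add]
    refine add_mem ?_ ?_
    · rw [mul_comm s u, map_mul, mul_assoc]
      exact mul_mem (O.algebraMap_mem _) hs'
    · rw [map_mul, mul_assoc]
      exact mul_mem (O.algebraMap_mem _) hu'
  | smul c x _ hx =>
    obtain ⟨s, hs, hs'⟩ := hx
    obtain ⟨m, n, hn, rfl⟩ := IsFractionRing.div_surjective (A := R) c
    have hn0 : n ≠ 0 := nonZeroDivisors.ne_zero hn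
    refine ⟨n * s, mul_ne_zero hn0 hs, ?_⟩
    have : algebraMap R F (n * s) * ((algebraMap R K m / algebraMap R K n) • x)
        = algebraMap R F m * (algebraMap R F s * x) := by
      have hnK : algebraMap R K n ≠ 0 := by simpa using hn0
      rw [IsScalarTower.algebraMap_apply R K F, IsScalarTower.algebraMap_apply R K F m,
        IsScalarTower.algebraMap_apply R K F s, ← Algebra.smul_def, ← Algebra.smul_def,
        ← Algebra.smul_def, smul_smul, smul_smul, map_mul]
      congr 1
      field_simp
    rw [this]
    exact mul_mem (O.algebraMap_mem _) hs'

end Order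

end HereditaryOrder

namespace HereditaryOrder

/-! ### The valuation defined by a generator of the radical -/

section Valuation

variable {R F : Type*} [CommRing R] [DivisionRing F] [Algebra R F]

/-- `ν` is the normalized valuation of `F` with valuation ring `O` and uniformizer `w`
(with an unspecified value at `0`). -/
structure IsNormalizedVal (O : Subalgebra R F) (w : F) (ν : F → ℤ) : Prop where
  map_mul : ∀ a b, a ≠ 0 → b ≠ 0 → ν (a * b) = ν a + ν b
  mem_iff : ∀ a, a ≠ 0 → (a ∈ O ↔ 0 ≤ ν a)
  mem_rad_iff : ∀ a, a ≠ 0 → (a ∈ rad O ↔ 1 ≤ ν a)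
  uniformizer_ne_zero : w ≠ 0
  map_uniformizer : ν w = 1

variable {O : Subalgebra R F} {w : F}

theorem IsRadGenerator.conj_mem (hw : IsRadGenerator O w) (hw0 : w ≠ 0) {a : F} (ha : a ∈ O) :
    w * a * w⁻¹ ∈ O ∧ w⁻¹ * a * w ∈ O := by
  constructor
  · have h : w * a ∈ (rad O : Set F) := by rw [hw.1]; exact ⟨a, ha, rfl⟩
    rw [hw.2] at h
    obtain ⟨b, hb, hab⟩ := h
    rwa [hab, mul_assoc, mul_inv_cancel₀ hw0, mul_one]
  · have h : a * w ∈ (rad O : Set F) := by rw [hw.2]; exact ⟨a, ha, rfl⟩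
    rw [hw.1] at h
    obtain ⟨b, hb, hab⟩ := h
    rwa [mul_assoc, hab, ← mul_assoc, inv_mul_cancel₀ hw0, one_mul]

theorem IsRadGenerator.zpow_conj_mem (hw : IsRadGenerator O w) (hw0 : w ≠ 0) {a : F} (ha : a ∈ O)
    (m : ℤ) : w ^ m * a * w ^ (-m) ∈ O := by
  induction m using Int.induction_on with
  | zero => simpa using ha
  | succ i ih =>
    have := (hw.conj_mem hw0 ih).1
    rw [zpow_neg] at this
    rw [add_comm, zpow_add₀ hw0, zpow_neg, zpow_add₀ hw0, mul_inv_rev, zpow_one]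
    simpa only [mul_assoc] using this
  | pred i ih =>
    have := (hw.conj_mem hw0 ih).2
    rw [sub_eq_add_neg, add_comm, zpow_add₀ hw0, neg_add, add_comm (- -1 : ℤ), zpow_add₀ hw0,
      neg_neg, zpow_neg_one, neg_neg, zpow_one]
    rw [neg_neg] at this
    simpa only [mul_assoc] using this

theorem IsRadGenerator.zpow_conj_isUnitOf (hw : IsRadGenerator O w) (hw0 : w ≠ 0) {a : F}
    (ha : IsUnitOf O a) (m : ℤ) : IsUnitOf O (w ^ m * a * w ^ (-m)) := by
  refine IsUnitOf.of_mul_eq_one (hw.zpow_conj_mem hw0 ha.mem m)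
    (hw.zpow_conj_mem hw0 ha.inv_mem m) ?_
  have : w ^ m ≠ 0 := zpow_ne_zero m hw0
  rw [zpow_neg]
  simp [mul_assoc, this, ha.ne_zero]

theorem IsRadGenerator.ne_zero (hw : IsRadGenerator O w)
    (hloc : ∀ a ∈ O, IsUnitOf O a ∨ IsUnitOf O (1 - a))
    (hex : ∃ a ∈ O, a ≠ 0 ∧ ¬ IsUnitOf O a) : w ≠ 0 := by
  rintro rfl
  obtain ⟨a, ha, ha0, hau⟩ := hex
  have h : a ∈ (rad O : Set F) := (mem_rad_iff_not_isUnitOf hloc).2 ⟨ha, hau⟩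
  rw [hw.1] at h
  obtain ⟨b, -, rfl⟩ := h
  simp at ha0

theorem IsRadGenerator.not_isUnitOf (hw : IsRadGenerator O w)
    (hloc : ∀ a ∈ O, IsUnitOf O a ∨ IsUnitOf O (1 - a)) : w ∈ O ∧ ¬ IsUnitOf O w := by
  rw [← mem_rad_iff_not_isUnitOf hloc, ← SetLike.mem_coe, hw.1]
  exact ⟨1, one_mem _, (mul_one w).symm⟩

/-- Noetherian induction on the left ideal `O a`. A nonunit is `a = w * b`, and `O a` is strictly
smaller than `O b`: otherwise `b = c * w * b`, making `w` a unit. -/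
theorem IsRadGenerator.exists_eq_pow_mul [IsNoetherian R O] (hw : IsRadGenerator O w)
    (hloc : ∀ a ∈ O, IsUnitOf O a ∨ IsUnitOf O (1 - a)) (a : O) (ha : a ≠ 0) :
    ∃ (n : ℕ) (u : F), IsUnitOf O u ∧ (a : F) = w ^ n * u := by
  have hwf : WellFounded (fun a b : O =>
      LinearMap.range (LinearMap.mulRight R a) > LinearMap.range (LinearMap.mulRight R b)) :=
    InvImage.wf (fun a : O => LinearMap.range (LinearMap.mulRight R a)) wellFounded_gt
  induction a using hwf.induction with
  | _ a ih =>
  by_cases hau : IsUnitOf O (a : F)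
  · exact ⟨0, a, hau, by simp⟩
  have h : (a : F) ∈ (rad O : Set F) := (mem_rad_iff_not_isUnitOf hloc).2 ⟨a.2, hau⟩
  have hwO := hw.not_isUnitOf hloc
  rw [hw.1] at h
  obtain ⟨b, hb, hab⟩ := h
  have hab' : a = ⟨w, hwO.1⟩ * ⟨b, hb⟩ := Subtype.ext hab
  have hb0 : b ≠ 0 := by
    rintro rfl
    exact ha (Subtype.ext (by simpa using hab))
  obtain ⟨n, u, hu, hbu⟩ := ih ⟨b, hb⟩ (by
    refine lt_of_le_of_ne ?_ fun heq => ?_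
    · rintro _ ⟨c, rfl⟩
      refine ⟨c * ⟨w, hwO.1⟩, ?_⟩
      simp [hab', mul_assoc]
    · have : (⟨b, hb⟩ : O) ∈ LinearMap.range (LinearMap.mulRight R a) := by
        rw [heq]
        exact ⟨1, by simp⟩
      obtain ⟨c, hc⟩ := this
      have hc' : c.1 * (w * b) = b := by
        rw [← hab]
        exact congrArg Subtype.val hc
      have hcw : c.1 * w = 1 := by
        apply mul_right_cancel₀ hb0
        rw [mul_assoc, hc', one_mul]
      have hc0 : c.1 ≠ 0 := by
        intro h0
        simp [h0] at hcw
      have hwc : w * c.1 = 1 := by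
        rw [← inv_eq_of_mul_eq_one_right hcw, inv_mul_cancel₀ hc0]
      exact hwO.2 (IsUnitOf.of_mul_eq_one hwO.1 c.2 hwc)) (fun h0 => hb0 (congrArg Subtype.val h0))
  refine ⟨n + 1, u, hu, ?_⟩
  change b = _ at hbu
  rw [hab, hbu, pow_succ', mul_assoc]

theorem IsRadGenerator.exists_eq_zpow_mul [IsNoetherian R O] (hw : IsRadGenerator O w)
    (hw0 : w ≠ 0) (hloc : ∀ a ∈ O, IsUnitOf O a ∨ IsUnitOf O (1 - a))
    (hden : ∀ a : F, ∃ s ∈ O, s ≠ 0 ∧ s * a ∈ O) (a : F) (ha : a ≠ 0) :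
    ∃ (n : ℤ) (u : F), IsUnitOf O u ∧ a = w ^ n * u := by
  obtain ⟨s, hs, hs0, hsa⟩ := hden a
  obtain ⟨n, u, hu, hnu⟩ := hw.exists_eq_pow_mul hloc ⟨s, hs⟩ (fun h => hs0 (congrArg Subtype.val h))
  obtain ⟨m, v, hv, hmv⟩ := hw.exists_eq_pow_mul hloc ⟨_, hsa⟩
    (fun h => mul_ne_zero hs0 ha (congrArg Subtype.val h))
  change s = _ at hnu
  change s * a = _ at hmv
  -- From `s = w ^ n * u` and `s * a = w ^ m * v` one gets `a = u⁻¹ * w ^ (m - n) * v`; conjugation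
  -- by a power of `w` moves `u⁻¹` to the right.
  refine ⟨m - n, _, (hw.zpow_conj_isUnitOf hw0 hu.inv (-(m - n))).mul hv, ?_⟩
  have h1 : u * a = w ^ (m - n : ℤ) * v := by
    apply mul_left_cancel₀ (pow_ne_zero n hw0)
    rw [← mul_assoc, ← hnu, hmv, ← mul_assoc, ← zpow_natCast w n, ← zpow_add₀ hw0, ← zpow_natCast]
    congr 2
    ring
  rw [neg_neg, zpow_neg, mul_assoc, mul_assoc, ← h1, inv_mul_cancel_left₀ hu.ne_zero,
    mul_inv_cancel_left₀ (zpow_ne_zero _ hw0)]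

theorem IsRadGenerator.zpow_isUnitOf (hw : IsRadGenerator O w)
    (hloc : ∀ a ∈ O, IsUnitOf O a ∨ IsUnitOf O (1 - a)) {n : ℤ} (h : IsUnitOf O (w ^ n)) :
    n = 0 := by
  have hwO := hw.not_isUnitOf hloc
  have key : ∀ k : ℕ, ¬ IsUnitOf O (w ^ (k + 1)) := by
    intro k hk
    have hmem := mul_mem (pow_mem hwO.1 k) hk.inv_mem
    refine hwO.2 (IsUnitOf.of_mul_eq_one hwO.1 hmem ?_)
    rw [← mul_assoc, ← pow_succ', mul_inv_cancel₀ hk.ne_zero]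
  rcases lt_trichotomy n 0 with hn | hn | hn
  · obtain ⟨k, hk⟩ := Int.eq_succ_of_zero_lt (neg_pos.2 hn)
    refine (key k ?_).elim
    have := h.inv
    rw [← zpow_neg, hk] at this
    exact_mod_cast this
  · exact hn
  · obtain ⟨k, rfl⟩ := Int.eq_succ_of_zero_lt hn
    exact (key k (by exact_mod_cast h)).elim

/-- A local order whose radical is generated by `w` on both sides is a discrete valuation ring
with uniformizer `w`. -/
theorem IsRadGenerator.exists_isNormalizedVal [IsNoetherian R O] (hw : IsRadGenerator O w)
    (hw0 : w ≠ 0) (hloc : ∀ a ∈ O, IsUnitOf O a ∨ IsUnitOf O (1 - a))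
    (hden : ∀ a : F, ∃ s ∈ O, s ≠ 0 ∧ s * a ∈ O) : ∃ ν : F → ℤ, IsNormalizedVal O w ν := by
  have hex : ∀ a : F, ∃ n : ℤ, a ≠ 0 → ∃ u, IsUnitOf O u ∧ a = w ^ n * u := by
    intro a
    by_cases ha : a = 0
    · exact ⟨0, fun h => (h ha).elim⟩
    · obtain ⟨n, h⟩ := hw.exists_eq_zpow_mul hw0 hloc hden a ha
      exact ⟨n, fun _ => h⟩
  choose ν hν using hex
  have huniq : ∀ (n : ℤ) (u : F), IsUnitOf O u → ν (w ^ n * u) = n := by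
    intro n u hu
    obtain ⟨v, hv, h⟩ := hν _ (mul_ne_zero (zpow_ne_zero n hw0) hu.ne_zero)
    generalize ν (w ^ n * u) = m at h
    have h1 : w ^ (m - n) = u * v⁻¹ := by
      rw [eq_mul_inv_iff_mul_eq₀ hv.ne_zero, sub_eq_neg_add, zpow_add₀ hw0, mul_assoc, ← h,
        zpow_neg, ← mul_assoc, inv_mul_cancel₀ (zpow_ne_zero n hw0), one_mul]
    have h2 := hw.zpow_isUnitOf hloc (h1 ▸ hu.mul hv.inv)
    omega
  have hwO := hw.not_isUnitOf hloc
  have hmem : ∀ (n : ℤ) (u : F), IsUnitOf O u → (w ^ n * u ∈ O ↔ 0 ≤ n) := by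
    intro n u hu
    constructor
    · intro h
      by_contra hn
      have h1 := mul_mem h hu.inv_mem
      rw [mul_assoc, mul_inv_cancel₀ hu.ne_zero, mul_one] at h1
      have h2 : (w ^ n)⁻¹ ∈ O := by
        rw [← zpow_neg]
        lift -n to ℕ using (by omega) with k
        rw [zpow_natCast]
        exact pow_mem hwO.1 k
      have := hw.zpow_isUnitOf hloc ⟨zpow_ne_zero n hw0, h1, h2⟩
      omega
    · intro hn
      lift n to ℕ using hn
      rw [zpow_natCast]
      exact mul_mem (pow_mem hwO.1 n) hu.mem
  refine ⟨ν, ⟨?_, ?_, ?_, hw0, ?_⟩⟩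
  · intro a b ha hb
    obtain ⟨u, hu, hau⟩ := hν a ha
    obtain ⟨v, hv, hbv⟩ := hν b hb
    have : a * b = w ^ (ν a + ν b) * (w ^ (-ν b) * u * w ^ (- -ν b) * v) := by
      conv_lhs => rw [hau, hbv]
      rw [zpow_add₀ hw0, neg_neg, zpow_neg]
      simp only [mul_assoc]
      rw [mul_inv_cancel_left₀ (zpow_ne_zero _ hw0)]
    rw [this]
    exact huniq _ _ ((hw.zpow_conj_isUnitOf hw0 hu _).mul hv)
  · intro a ha
    obtain ⟨u, hu, hau⟩ := hν a ha
    conv_lhs => rw [hau]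
    exact hmem _ _ hu
  · intro a ha
    obtain ⟨u, hu, hau⟩ := hν a ha
    rw [← SetLike.mem_coe, hw.1]
    have h1 : a = w * (w ^ (ν a - 1) * u) := by
      conv_lhs => rw [hau]
      rw [← mul_assoc, ← zpow_one_add₀ hw0]
      congr 2
      ring
    constructor
    · rintro ⟨b, hb, hab⟩
      have : b = w ^ (ν a - 1) * u := by
        apply mul_left_cancel₀ hw0
        rw [← hab]
        exact h1
      have := (hmem _ _ hu).1 (this ▸ hb)
      omega
    · intro h
      exact ⟨_, (hmem _ _ hu).2 (by omega), h1⟩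
  · have := huniq 1 1 isUnitOf_one
    simpa using this

end Valuation

end HereditaryOrder

namespace HereditaryOrder

/-! ### The ultrametric inequality -/

section ValuationLemmas

variable {R F : Type*} [CommRing R] [DivisionRing F] [Algebra R F]
  {O : Subalgebra R F} {w : F} {ν : F → ℤ}

theorem IsNormalizedVal.map_one (hν : IsNormalizedVal O w ν) : ν 1 = 0 := by
  have := hν.map_mul 1 1 one_ne_zero one_ne_zero
  rw [mul_one] at this
  omega

theorem IsNormalizedVal.map_inv (hν : IsNormalizedVal O w ν) {a : F} (ha : a ≠ 0) :
    ν a⁻¹ = - ν a := by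
  have := hν.map_mul a a⁻¹ ha (inv_ne_zero ha)
  rw [mul_inv_cancel₀ ha, hν.map_one] at this
  omega

theorem IsNormalizedVal.map_zpow (hν : IsNormalizedVal O w ν) (n : ℤ) : ν (w ^ n) = n := by
  have hw0 := hν.uniformizer_ne_zero
  have hpow : ∀ k : ℕ, ν (w ^ k) = k := by
    intro k
    induction k with
    | zero => simpa using hν.map_one
    | succ k ih =>
      rw [pow_succ, hν.map_mul _ _ (pow_ne_zero k hw0) hw0, ih, hν.map_uniformizer]
      push_cast
      ring
  obtain ⟨k, rfl | rfl⟩ := n.eq_nat_or_neg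
  · rw [zpow_natCast, hpow]
  · rw [zpow_neg, zpow_natCast, hν.map_inv (pow_ne_zero k hw0), hpow]

/-- If all terms had valuation above `m`, scaling by `w ^ (-(m + 1))` would put them, hence their
sum, in `O`. -/
theorem IsNormalizedVal.exists_map_le_map_sum (hν : IsNormalizedVal O w ν) {ι : Type*}
    (s : Finset ι) (f : ι → F) (hs : ∑ i ∈ s, f i ≠ 0) :
    ∃ i ∈ s, f i ≠ 0 ∧ ν (f i) ≤ ν (∑ i ∈ s, f i) := by
  by_contra! hcon
  set m := ν (∑ i ∈ s, f i)
  have hw0 := hν.uniformizer_ne_zero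
  have hz : w ^ (-(m + 1)) ≠ 0 := zpow_ne_zero _ hw0
  have hmem : w ^ (-(m + 1)) * ∑ i ∈ s, f i ∈ O := by
    rw [Finset.mul_sum]
    refine sum_mem fun i hi => ?_
    by_cases h0 : f i = 0
    · rw [h0, mul_zero]
      exact zero_mem _
    · rw [hν.mem_iff _ (mul_ne_zero hz h0), hν.map_mul _ _ hz h0, hν.map_zpow]
      have := hcon i hi h0
      omega
  rw [hν.mem_iff _ (mul_ne_zero hz hs), hν.map_mul _ _ hz hs, hν.map_zpow] at hmem
  omega

end ValuationLemmas

/-! ### The lattice chain and the normalizer acting on it -/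

section Filtration

open Matrix

variable {F ι : Type*} [DivisionRing F] {r : ℕ}

/-- The chain of lattices of row vectors attached to the block structure `β`. -/
def filtration (ν : F → ℤ) (β : ι → Fin r) (j : ℤ) : Set (ι → F) :=
  {v | ∀ b, v b ≠ 0 → j ≤ r * ν (v b) - (β b : ℕ)}

/-- The matrices preserving the chain `filtration ν β`, in terms of the valuations of their
entries. -/
def IsBlockIntegral (ν : F → ℤ) (β : ι → Fin r) (x : Matrix ι ι F) : Prop :=
  ∀ a b, x a b ≠ 0 → ((β b : ℕ) : ℤ) - (β a : ℕ) ≤ r * ν (x a b)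

/-- Multiplication by `x` on the right shifts the chain `filtration ν β` by `c`. -/
def IsShift [Fintype ι] (ν : F → ℤ) (β : ι → Fin r) (x : Matrix ι ι F) (c : ℤ) : Prop :=
  ∀ j v, v ∈ filtration ν β j ↔ v ᵥ* x ∈ filtration ν β (j + c)

variable {ν : F → ℤ} {β : ι → Fin r}

theorem filtration_antitone {i j : ℤ} (h : i ≤ j) : filtration ν β j ⊆ filtration ν β i :=
  fun _ hv b hb => h.trans (hv b hb)

theorem exists_mem_filtration_not_mem [Fintype ι] {v : ι → F} (hv : v ≠ 0) :
    ∃ j, v ∈ filtration ν β j ∧ v ∉ filtration ν β (j + 1) := by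
  classical
  obtain ⟨b₀, hb₀⟩ := Function.ne_iff.1 hv
  obtain ⟨b, hb, hmin⟩ := Finset.exists_min_image (Finset.univ.filter fun b => v b ≠ 0)
    (fun b => r * ν (v b) - ((β b : ℕ) : ℤ)) ⟨b₀, by simpa using hb₀⟩
  refine ⟨r * ν (v b) - ((β b : ℕ) : ℤ), fun c hc => hmin c (by simpa using hc), fun h => ?_⟩
  have := h b (by simpa using hb)
  omega

theorem IsShift.mul [Fintype ι] {x y : Matrix ι ι F} {c d : ℤ} (hx : IsShift ν β x c)
    (hy : IsShift ν β y d) : IsShift ν β (x * y) (c + d) := by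
  intro j v
  rw [hx, hy, vecMul_vecMul, add_assoc]

theorem isShift_one [Fintype ι] [DecidableEq ι] : IsShift ν β (1 : Matrix ι ι F) 0 := by
  intro j v
  rw [vecMul_one, add_zero]

theorem IsShift.pow [Fintype ι] [DecidableEq ι] {x : Matrix ι ι F} {c : ℤ}
    (hx : IsShift ν β x c) (k : ℕ) : IsShift ν β (x ^ k) (k * c) := by
  induction k with
  | zero => simpa using isShift_one
  | succ k ih =>
    rw [pow_succ]
    convert! ih.mul hx using 1
    push_cast
    ring

theorem IsShift.units_inv [Fintype ι] [DecidableEq ι] {x : (Matrix ι ι F)ˣ} {c : ℤ}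
    (hx : IsShift ν β (x : Matrix ι ι F) c) :
    IsShift ν β ((x⁻¹ : (Matrix ι ι F)ˣ) : Matrix ι ι F) (-c) := by
  intro j v
  rw [hx (j + -c), vecMul_vecMul, Units.inv_mul, vecMul_one]
  simp

section

variable {R : Type*} [CommRing R] [Algebra R F] {O : Subalgebra R F} {w : F}

theorem IsBlockIntegral.vecMul_mem [Fintype ι] (hν : IsNormalizedVal O w ν) {x : Matrix ι ι F}
    (hx : IsBlockIntegral ν β x) {j : ℤ} {v : ι → F} (hv : v ∈ filtration ν β j) :
    v ᵥ* x ∈ filtration ν β j := by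
  intro b hb
  obtain ⟨a, -, ha, hle⟩ := hν.exists_map_le_map_sum Finset.univ (fun a => v a * x a b) hb
  change ν (v a * x a b) ≤ ν ((v ᵥ* x) b) at hle
  rw [hν.map_mul _ _ (left_ne_zero_of_mul ha) (right_ne_zero_of_mul ha)] at hle
  have h1 := hv a (left_ne_zero_of_mul ha)
  have h2 := hx a b (right_ne_zero_of_mul ha)
  nlinarith

variable [DecidableEq ι]

theorem exists_mem_filtration_of_surjective (hr : 0 < r) (hν : IsNormalizedVal O w ν)
    (hβ : Function.Surjective β) (j : ℤ) :
    ∃ v, v ≠ 0 ∧ v ∈ filtration ν β j ∧ v ∉ filtration ν β (j + 1) := by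
  have hr' : (0 : ℤ) < r := by exact_mod_cast hr
  have hmod := Int.emod_nonneg (-j) hr'.ne'
  have hlt := Int.emod_lt_of_pos (-j) hr'
  obtain ⟨a, ha⟩ := hβ ⟨((-j) % r).toNat, by omega⟩
  have ha' : ((β a : ℕ) : ℤ) = (-j) % r := by
    rw [ha]
    simpa using hmod
  -- A vector supported at one position of block `i` has height congruent to `-i` modulo `r`, so `i`
  -- must be the residue of `-j`.
  have hj : j = r * (-((-j) / r)) - (β a : ℕ) := by
    have := Int.mul_ediv_add_emod (-j) r
    rw [ha', mul_neg]
    omega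
  have hne : w ^ (-((-j) / r)) ≠ 0 := zpow_ne_zero _ hν.uniformizer_ne_zero
  refine ⟨Pi.single a (w ^ (-((-j) / r))), by simpa using hne, ?_, ?_⟩
  · intro b hb
    obtain rfl : b = a := by
      by_contra hba
      exact hb (Pi.single_eq_of_ne hba _)
    rw [Pi.single_eq_same, hν.map_zpow]
    exact hj.le
  · intro h
    have := h a (by simpa using hne)
    rw [Pi.single_eq_same, hν.map_zpow] at this
    omega

variable [Fintype ι]

theorem isBlockIntegral_of_vecMul_mem (hν : IsNormalizedVal O w ν) {x : Matrix ι ι F}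
    (hx : ∀ j v, v ∈ filtration ν β j → v ᵥ* x ∈ filtration ν β j) : IsBlockIntegral ν β x := by
  intro a b hab
  have h1 : Pi.single a (1 : F) ∈ filtration ν β (-(β a : ℕ)) := by
    intro c hc
    obtain rfl : c = a := by
      by_contra hne
      exact hc (Pi.single_eq_of_ne hne _)
    rw [Pi.single_eq_same, hν.map_one]
    simp
  have h2 := hx _ _ h1 b
  rw [single_one_vecMul] at h2
  have := h2 hab
  change _ ≤ r * ν (x a b) - _ at this
  omega

/-- The matrices preserving the chain act transitively on vectors, up to height. -/
theorem exists_isBlockIntegral_vecMul_eq (hν : IsNormalizedVal O w ν) {j : ℤ} {v u : ι → F}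
    (hv : v ∉ filtration ν β (j + 1)) (hu : u ∈ filtration ν β j) :
    ∃ x, IsBlockIntegral ν β x ∧ v ᵥ* x = u := by
  simp only [filtration, Set.mem_ofPred_eq, not_forall] at hv
  obtain ⟨a, ha, hlt⟩ := hv
  -- Only row `a` is used, where `v` has height contribution at most `j`; this is what makes the
  -- matrix preserve the chain.
  refine ⟨Matrix.of fun c b => if c = a then (v a)⁻¹ * u b else 0, ?_, ?_⟩
  · intro c b hcb
    simp only [of_apply] at hcb ⊢
    split_ifs at hcb ⊢ with h
    · subst h
      have hub : u b ≠ 0 := right_ne_zero_of_mul hcb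
      have := hu b hub
      rw [hν.map_mul _ _ (inv_ne_zero ha) hub, hν.map_inv ha, mul_add, mul_neg]
      omega
    · exact (hcb rfl).elim
  · ext b
    simp [vecMul, dotProduct, ha]

theorem IsShift.isBlockIntegral (hν : IsNormalizedVal O w ν) {x : Matrix ι ι F}
    (hx : IsShift ν β x 0) : IsBlockIntegral ν β x :=
  isBlockIntegral_of_vecMul_mem hν fun j v hv => by simpa using (hx j v).1 hv

/-- A matrix which shifts the chain is invertible. -/
theorem IsShift.isUnit {x : Matrix ι ι F} {c : ℤ} (hx : IsShift ν β x c) : IsUnit x := by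
  have hker : ∀ v : ι → F, v ᵥ* x = 0 → v = 0 := by
    intro v hv
    by_contra hv0
    obtain ⟨j, -, hj⟩ := exists_mem_filtration_not_mem (ν := ν) (β := β) hv0
    refine hj ((hx _ _).2 ?_)
    rw [hv]
    intro b hb
    exact (hb rfl).elim
  have hinj : Function.Injective x.vecMulLinear := by
    rw [injective_iff_map_eq_zero]
    exact hker
  have hsurj : Function.Surjective x.vecMulLinear := LinearMap.injective_iff_surjective.1 hinj
  choose z hz using fun i => hsurj (Pi.single i 1)
  have hzx : Matrix.of z * x = 1 := by
    ext i k
    have := congrFun (hz i) k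
    rw [one_apply]
    refine Eq.trans this ?_
    rw [Pi.single_apply]
    simp only [eq_comm]
  refine ⟨⟨x, Matrix.of z, ?_, hzx⟩, rfl⟩
  -- The left inverse is also a right inverse: each row of `x z - 1` is killed by `x`.
  have h0 : (x * Matrix.of z - 1) * x = 0 := by
    rw [sub_mul, mul_assoc, hzx, mul_one, one_mul, sub_self]
  rw [← sub_eq_zero]
  ext i k
  exact congrFun (hker ((x * Matrix.of z - 1) i) (congrFun h0 i)) k

variable {H : Subalgebra R (Matrix ι ι F)}

theorem mem_normalizer_iff {A : Type*} [Ring A] [Algebra R A] {H : Subalgebra R A} {x : Aˣ} :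
    x ∈ normalizer H ↔ (∀ a ∈ H, (x : A) * a * ((x⁻¹ : Aˣ) : A) ∈ H) ∧
      ∀ a ∈ H, ((x⁻¹ : Aˣ) : A) * a * (x : A) ∈ H := by
  constructor
  · intro hx
    refine ⟨fun a ha => ?_, fun a ha => ?_⟩
    · rw [← SetLike.mem_coe, ← (show _ = (H : Set A) from hx)]
      exact ⟨a, ha, rfl⟩
    · rw [← SetLike.mem_coe, ← (show _ = (H : Set A) from hx)] at ha
      obtain ⟨b, hb, rfl⟩ := ha
      simpa [mul_assoc] using hb
  · rintro ⟨h1, h2⟩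
    apply Set.Subset.antisymm
    · rintro _ ⟨a, ha, rfl⟩
      exact h1 a ha
    · intro a ha
      exact ⟨_, h2 a ha, by simp [mul_assoc]⟩

theorem IsShift.mem_normalizer (hν : IsNormalizedVal O w ν)
    (hH : ∀ x, x ∈ H ↔ IsBlockIntegral ν β x) {x : (Matrix ι ι F)ˣ} {c : ℤ}
    (hx : IsShift ν β (x : Matrix ι ι F) c) : x ∈ normalizer H := by
  have key : ∀ (y : (Matrix ι ι F)ˣ) (d : ℤ), IsShift ν β (y : Matrix ι ι F) d →
      ∀ a ∈ H, (y : Matrix ι ι F) * a * ((y⁻¹ : (Matrix ι ι F)ˣ) : Matrix ι ι F) ∈ H := by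
    intro y d hy a ha
    rw [hH] at ha ⊢
    refine isBlockIntegral_of_vecMul_mem hν fun j v hv => ?_
    rw [← vecMul_vecMul, ← vecMul_vecMul]
    have := (hy.units_inv _ _).1 (ha.vecMul_mem hν ((hy _ _).1 hv))
    simpa using this
  rw [mem_normalizer_iff]
  refine ⟨key x c hx, ?_⟩
  simpa using key x⁻¹ _ hx.units_inv

/-- An element of the normalizer maps the chain to itself, up to reindexing. -/
theorem mem_filtration_iff_of_mem_normalizer (hν : IsNormalizedVal O w ν)
    (hH : ∀ x, x ∈ H ↔ IsBlockIntegral ν β x) {x : (Matrix ι ι F)ˣ} (hx : x ∈ normalizer H)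
    {v : ι → F} {j k : ℤ} (hj : v ∈ filtration ν β j) (hj' : v ∉ filtration ν β (j + 1))
    (hk : v ᵥ* (x : Matrix ι ι F) ∈ filtration ν β k)
    (hk' : v ᵥ* (x : Matrix ι ι F) ∉ filtration ν β (k + 1)) (u : ι → F) :
    u ∈ filtration ν β j ↔ u ᵥ* (x : Matrix ι ι F) ∈ filtration ν β k := by
  rw [mem_normalizer_iff] at hx
  constructor
  · intro hu
    -- With `u = v y`, one has `u x = (v x)(x⁻¹ y x)`, and `x⁻¹ y x` lies in `H`.
    obtain ⟨y, hy, rfl⟩ := exists_isBlockIntegral_vecMul_eq hν hj' hu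
    have h1 := (hH _).1 (hx.2 y ((hH y).2 hy))
    have h2 := h1.vecMul_mem hν hk
    simpa [vecMul_vecMul, ← mul_assoc] using h2
  · intro hu
    obtain ⟨y, hy, hyu⟩ := exists_isBlockIntegral_vecMul_eq hν hk' hu
    have h1 := (hH _).1 (hx.1 y ((hH y).2 hy))
    have h2 := h1.vecMul_mem hν hj
    have h3 : v ᵥ* ((x : Matrix ι ι F) * y * ((x⁻¹ : (Matrix ι ι F)ˣ) : Matrix ι ι F)) = u := by
      rw [← vecMul_vecMul, ← vecMul_vecMul, hyu, vecMul_vecMul, Units.mul_inv, vecMul_one]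
    rwa [h3] at h2

theorem vecMul_units_ne_zero (x : (Matrix ι ι F)ˣ) {v : ι → F} (hv : v ≠ 0) :
    v ᵥ* (x : Matrix ι ι F) ≠ 0 := by
  intro h
  apply hv
  have := congrArg (fun u => u ᵥ* ((x⁻¹ : (Matrix ι ι F)ˣ) : Matrix ι ι F)) h
  simpa [vecMul_vecMul] using this

/-- A strictly increasing surjection cannot skip a value, so consecutive integers go to consecutive
integers. -/
theorem int_eq_add_of_strictMono_surjective {φ : ℤ → ℤ} (hmono : StrictMono φ)
    (hsurj : Function.Surjective φ) (j : ℤ) : φ j = j + φ 0 := by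
  have hstep : ∀ j, φ (j + 1) = φ j + 1 := by
    intro j
    obtain ⟨k, hk⟩ := hsurj (φ j + 1)
    have h1 : φ j < φ (j + 1) := hmono (by omega)
    have h2 : j < k := hmono.lt_iff_lt.1 (by omega)
    have h3 : φ (j + 1) ≤ φ k := hmono.monotone (by omega)
    omega
  induction j using Int.induction_on with
  | zero => simp
  | succ i ih => rw [hstep, ih]; ring
  | pred i ih =>
    have := hstep (-(i : ℤ) - 1)
    rw [sub_add_cancel] at this
    omega

/-- Every element of the normalizer shifts the chain by some integer. -/
theorem exists_isShift_of_mem_normalizer (hr : 0 < r) (hν : IsNormalizedVal O w ν)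
    (hβ : Function.Surjective β) (hH : ∀ x, x ∈ H ↔ IsBlockIntegral ν β x)
    {x : (Matrix ι ι F)ˣ} (hx : x ∈ normalizer H) :
    ∃ c, IsShift ν β (x : Matrix ι ι F) c := by
  choose e he0 he he' using exists_mem_filtration_of_surjective (F := F) hr hν hβ
  choose φ hφ hφ' using fun j =>
    exists_mem_filtration_not_mem (ν := ν) (β := β) (vecMul_units_ne_zero x (he0 j))
  have key : ∀ j u, u ∈ filtration ν β j ↔ u ᵥ* (x : Matrix ι ι F) ∈ filtration ν β (φ j) :=
    fun j => mem_filtration_iff_of_mem_normalizer hν hH hx (he j) (he' j) (hφ j) (hφ' j)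
  have hmono : StrictMono φ := by
    refine strictMono_int_of_lt_succ fun j => ?_
    by_contra! hle
    exact he' j ((key (j + 1) _).2 (filtration_antitone hle (hφ j)))
  have hsurj : Function.Surjective φ := by
    intro k
    -- If `u = e k x⁻¹` has height `j`, then `L_j x` is both `L_k` and `L_(φ j)`, which forces `φ j
    -- = k`.
    set u := e k ᵥ* ((x⁻¹ : (Matrix ι ι F)ˣ) : Matrix ι ι F) with hu
    have hux : u ᵥ* (x : Matrix ι ι F) = e k := by simp [hu, vecMul_vecMul]
    obtain ⟨j, hj, hj'⟩ := exists_mem_filtration_not_mem (ν := ν) (β := β)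
      (vecMul_units_ne_zero x⁻¹ (he0 k))
    have key' := mem_filtration_iff_of_mem_normalizer hν hH hx hj hj'
      (k := k) (by rw [← hu, hux]; exact he k) (by rw [← hu, hux]; exact he' k)
    refine ⟨j, ?_⟩
    apply le_antisymm
    · by_contra! hlt
      have h1 := (key j _).1 hj
      rw [← hu, hux] at h1
      exact he' k (filtration_antitone (by omega) h1)
    · by_contra! hlt
      exact hφ' j (filtration_antitone (by omega) ((key' _).1 (he j)))
  refine ⟨φ 0, fun j u => ?_⟩
  rw [← int_eq_add_of_strictMono_surjective hmono hsurj]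
  exact key j u

end

end Filtration

end HereditaryOrder

namespace HereditaryOrder

/-! ### Comparing block sizes along a shift -/

section FiberCard

open Matrix

variable {F ι : Type*} [DivisionRing F] {r : ℕ} {ν : F → ℤ} {β : ι → Fin r} [Fintype ι]

/-- A shift of the chain maps the graded piece of block `i` injectively to that of its image. -/
theorem IsShift.card_fiber_le [DecidableEq ι] {x : Matrix ι ι F} {c : ℤ} (hx : IsShift ν β x c)
    {i i' : Fin r} (h : ((i' : ℕ) : ℤ) ≡ (i : ℕ) - c [ZMOD r]) :
    Fintype.card {a // β a = i} ≤ Fintype.card {b // β b = i'} := by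
  by_contra! hlt
  -- This is the submatrix of `x` from block `i` to block `i'`; dimensions over `F` replace those of
  -- graded pieces over the residue field. A nonzero `v` supported in block `i` has height `≡ -i`,
  -- so `v x` has height `≡ -i'` modulo `r`, attained only in block `i'`. Hence `f` has no kernel.
  let f : ({a // β a = i} → F) →ₗ[F] ({b // β b = i'} → F) :=
    (LinearMap.funLeft F F Subtype.val).comp
      (x.vecMulLinear.comp (Function.ExtendByZero.linearMap F Subtype.val))
  have hker : LinearMap.ker f ≠ ⊥ := LinearMap.ker_ne_bot_of_finrank_lt (by simpa using hlt)
  obtain ⟨s, hs, hs0⟩ := Submodule.exists_mem_ne_zero_of_ne_bot hker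
  set v : ι → F := Function.extend Subtype.val s 0 with hv
  have hvi : ∀ a, v a ≠ 0 → β a = i := by
    intro a ha
    by_contra hne
    apply ha
    rw [hv, Function.extend_apply']
    · rfl
    · rintro ⟨a', rfl⟩
      exact hne a'.2
  have hv0 : v ≠ 0 := by
    obtain ⟨a, ha⟩ := Function.ne_iff.1 hs0
    refine Function.ne_iff.2 ⟨a.1, ?_⟩
    rwa [hv, Subtype.val_injective.extend_apply]
  have hvx : ∀ b, β b = i' → (v ᵥ* x) b = 0 := by
    intro b hb
    exact congrFun (LinearMap.mem_ker.1 hs) ⟨b, hb⟩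
  obtain ⟨j, hj, hj'⟩ := exists_mem_filtration_not_mem (ν := ν) (β := β) hv0
  have hk := (hx _ _).1 hj
  have hk' := (not_congr (hx _ _)).1 hj'
  simp only [filtration, Set.mem_ofPred_eq, not_forall] at hj' hk'
  obtain ⟨a, ha, hlta⟩ := hj'
  obtain ⟨b, hb, hltb⟩ := hk'
  have h1 := hj a ha
  have h2 := hk b hb
  have hai := hvi a ha
  apply hb
  apply hvx
  apply Fin.ext
  have hcong : ((β b : ℕ) : ℤ) ≡ (i' : ℕ) [ZMOD r] := by
    refine Int.ModEq.trans ?_ h.symm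
    rw [Int.modEq_iff_dvd]
    refine ⟨ν (v a) - ν ((v ᵥ* x) b), ?_⟩
    rw [hai] at h1 hlta
    rw [mul_sub]
    omega
  have hcong' : (β b : ℕ) ≡ (i' : ℕ) [MOD r] := (Int.natCast_modEq_iff).1 hcong
  exact Nat.ModEq.eq_of_lt_of_lt hcong' (β b).2 i'.2

end FiberCard

/-! ### Periods of the block sizes and positions of the blocks -/

section Block

variable {r : ℕ}

theorem block_surjective {p : Fin r → ℕ} (hp : ∀ i, 1 ≤ p i) : Function.Surjective (block p) := by
  intro i
  exact ⟨finSigmaFinEquiv ⟨i, ⟨0, hp i⟩⟩, by simp [block]⟩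

theorem card_block_fiber (p : Fin r → ℕ) (i : Fin r) :
    Fintype.card {a // block p a = i} = p i := by
  have e : {a // block p a = i} ≃ Fin (p i) :=
    (finSigmaFinEquiv.symm.subtypeEquiv fun _ => Iff.rfl).trans (Equiv.sigmaSubtype i)
  rw [Fintype.card_congr e, Fintype.card_fin]

/-- The residue of an integer modulo `r`, as an element of `Fin r`. -/
def residueIndex (hr : 1 ≤ r) (z : ℤ) : Fin r :=
  ⟨(z % r).toNat, by
    have := Int.emod_nonneg z (b := (r : ℤ)) (by omega)
    have := Int.emod_lt_of_pos z (b := (r : ℤ)) (by omega)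
    omega⟩

theorem residueIndex_modEq (hr : 1 ≤ r) (z : ℤ) :
    ((residueIndex hr z : ℕ) : ℤ) ≡ z [ZMOD r] := by
  have := Int.emod_nonneg z (b := (r : ℤ)) (by omega)
  simp only [residueIndex, Int.toNat_of_nonneg this]
  exact Int.mod_modEq z r

theorem residueIndex_natCast (hr : 1 ≤ r) {i : ℕ} (hi : i < r) :
    residueIndex hr i = ⟨i, hi⟩ := by
  apply Fin.ext
  have h := (Int.natCast_modEq_iff).1 (residueIndex_modEq hr i)
  exact Nat.ModEq.eq_of_lt_of_lt h (residueIndex hr i).2 hi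

/-- The extension of `p` to a function on the integers with period `r`. -/
def periodicExt (hr : 1 ≤ r) (p : Fin r → ℕ) (z : ℤ) : ℕ := p (residueIndex hr z)

theorem periodicExt_val (hr : 1 ≤ r) (p : Fin r → ℕ) (i : Fin r) :
    periodicExt hr p (i : ℕ) = p i := by
  rw [periodicExt, residueIndex_natCast hr i.2]

theorem IsPeriod.periodic_periodicExt {p : Fin r → ℕ} {t : ℕ} (ht : IsPeriod p t) (hr : 1 ≤ r) :
    Function.Periodic (periodicExt hr p) t := by
  intro z
  apply ht.2.2
  have hd : (t : ℤ) ∣ r := by exact_mod_cast ht.2.1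
  rw [← Int.natCast_modEq_iff]
  refine ((residueIndex_modEq hr _).of_dvd hd).trans
    (Int.ModEq.trans ?_ ((residueIndex_modEq hr z).of_dvd hd).symm)
  simp [Int.ModEq]

theorem isPeriod_of_periodic {p : Fin r → ℕ} {t : ℕ} (hr : 1 ≤ r) (ht : 1 ≤ t) (htr : t ∣ r)
    (h : Function.Periodic (periodicExt hr p) t) : IsPeriod p t := by
  refine ⟨ht, htr, fun i j hij => ?_⟩
  rw [← Int.natCast_modEq_iff, Int.modEq_iff_dvd] at hij
  obtain ⟨m, hm⟩ := hij
  have := h.int_mul m (i : ℕ)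
  rw [← periodicExt_val hr p i, ← periodicExt_val hr p j, ← this]
  congr 1
  simp only [Int.cast_id]
  linarith

/-- The smallest period divides all periods of the periodic extension. -/
theorem natCast_dvd_of_isLeast_of_periodic {p : Fin r → ℕ} {t : ℕ} (ht : IsLeast {s | IsPeriod p s} t)
    (hr : 1 ≤ r) {c : ℤ} (hc : Function.Periodic (periodicExt hr p) c) : (t : ℤ) ∣ c := by
  have ht1 : IsPeriod p t := ht.1
  -- By Bézout the gcd is a period too; it divides `t`, hence `r`, so minimality of `t` applies to
  -- it.
  have hper : Function.Periodic (periodicExt hr p) (Int.gcd t c) := by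
    rw [Int.gcd_eq_gcd_ab]
    have h1 := (ht1.periodic_periodicExt hr).int_mul (Int.gcdA t c)
    have h2 := hc.int_mul (Int.gcdB t c)
    have := h1.add_period h2
    simpa [mul_comm] using this
  have hdt : Int.gcd t c ∣ t := by
    have := Int.gcd_dvd_left t c
    exact_mod_cast this
  have hpos : 1 ≤ Int.gcd t c := Nat.pos_of_dvd_of_pos hdt ht1.1
  have hle : t ≤ Int.gcd t c :=
    ht.2 (isPeriod_of_periodic hr hpos (hdt.trans ht1.2.1) hper)
  have heq : Int.gcd t c = t := le_antisymm (Nat.le_of_dvd ht1.1 hdt) hle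
  have := Int.gcd_dvd_right t c
  rwa [heq] at this

/-- The number of positions in the first `m` blocks of the periodic extension of `p`. -/
def prefixSize (hr : 1 ≤ r) (p : Fin r → ℕ) (m : ℕ) : ℕ :=
  ∑ i ∈ Finset.range m, periodicExt hr p i

theorem prefixSize_mono (hr : 1 ≤ r) (p : Fin r → ℕ) : Monotone (prefixSize hr p) := by
  intro m n h
  exact Finset.sum_le_sum_of_subset (Finset.range_mono h)

theorem prefixSize_self (hr : 1 ≤ r) (p : Fin r → ℕ) : prefixSize hr p r = ∑ i, p i := by
  rw [prefixSize, Finset.sum_range]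
  exact Finset.sum_congr rfl fun i _ => periodicExt_val hr p i

theorem prefixSize_eq_partialSize (hr : 1 ≤ r) (p : Fin r → ℕ) {t : ℕ} (ht : t ≤ r) :
    prefixSize hr p t = partialSize p t := by
  rw [prefixSize, partialSize, Finset.sum_filter]
  rw [← Finset.sum_congr rfl (fun (i : Fin r) _ =>
    (show (if (i : ℕ) < t then periodicExt hr p (i : ℕ) else 0) = _ by rw [periodicExt_val]))]
  rw [← Finset.sum_range (fun i : ℕ => if i < t then periodicExt hr p i else 0),
    ← Finset.sum_filter]
  apply Finset.sum_congr _ fun _ _ => rfl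
  ext i
  simp only [Finset.mem_range, Finset.mem_filter]
  omega

theorem prefixSize_add {p : Fin r → ℕ} (hr : 1 ≤ r) {t : ℕ}
    (h : Function.Periodic (periodicExt hr p) t) (m : ℕ) :
    prefixSize hr p (m + t) = prefixSize hr p m + prefixSize hr p t := by
  rw [add_comm m, prefixSize, Finset.sum_range_add, add_comm]
  congr 1
  refine Finset.sum_congr rfl fun i _ => ?_
  rw [← h (i : ℤ)]
  congr 1
  push_cast
  ring

/-- With `eq_of_prefixSize_le_lt`, these bounds determine the block index, reducing block
computations to arithmetic of partial sums. -/
theorem prefixSize_block (hr : 1 ≤ r) (p : Fin r → ℕ) (a : Fin (∑ i, p i)) :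
    prefixSize hr p (block p a) ≤ a ∧ (a : ℕ) < prefixSize hr p (block p a + 1) := by
  obtain ⟨s, rfl⟩ := finSigmaFinEquiv.surjective a
  have hb : block p (finSigmaFinEquiv s) = s.1 := by simp [block]
  have hpre : ∑ i : Fin s.1, p (Fin.castLE s.1.2.le i) = prefixSize hr p s.1 := by
    rw [prefixSize, Finset.sum_range]
    exact Finset.sum_congr rfl fun i _ => (periodicExt_val hr p (Fin.castLE s.1.2.le i)).symm
  have hsucc : prefixSize hr p (s.1 + 1) = prefixSize hr p s.1 + p s.1 := by
    rw [prefixSize, Finset.sum_range_succ, periodicExt_val]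
    rfl
  rw [hb, finSigmaFinEquiv_apply, hpre, hsucc]
  have := s.2.2
  omega

theorem eq_of_prefixSize_le_lt {p : Fin r → ℕ} (hr : 1 ≤ r) {a m n : ℕ}
    (hm : prefixSize hr p m ≤ a) (hm' : a < prefixSize hr p (m + 1))
    (hn : prefixSize hr p n ≤ a) (hn' : a < prefixSize hr p (n + 1)) : m = n := by
  by_contra hne
  rcases lt_or_gt_of_ne hne with h | h
  · exact absurd (prefixSize_mono hr p (show m + 1 ≤ n from h)) (by omega)
  · exact absurd (prefixSize_mono hr p (show n + 1 ≤ m from h)) (by omega)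

theorem periodic_self (hr : 1 ≤ r) (p : Fin r → ℕ) : Function.Periodic (periodicExt hr p) r := by
  refine IsPeriod.periodic_periodicExt ⟨hr, dvd_rfl, fun i j hij => ?_⟩ hr
  rw [Fin.ext (Nat.ModEq.eq_of_lt_of_lt hij i.2 j.2)]

/-- Moving `q = p₁ + ⋯ + p_t` positions ahead, cyclically, means moving `t` blocks ahead. -/
theorem block_of_eq_add {p : Fin r → ℕ} {t : ℕ} (hr : 1 ≤ r) (ht : IsPeriod p t)
    {a b : Fin (∑ i, p i)} (h : (a : ℕ) = b + partialSize p t) :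
    (block p a : ℕ) = block p b + t := by
  have htr : t ≤ r := Nat.le_of_dvd hr ht.2.1
  have hper := ht.periodic_periodicExt hr
  rw [← prefixSize_eq_partialSize hr p htr] at h
  obtain ⟨ha, ha'⟩ := prefixSize_block hr p a
  obtain ⟨hb, hb'⟩ := prefixSize_block hr p b
  refine eq_of_prefixSize_le_lt hr ha ha' ?_ ?_
  · rw [prefixSize_add hr hper]
    omega
  · rw [add_right_comm, prefixSize_add hr hper]
    omega

/-- The wrap-around case: in the periodic extension, position `a + ∑ i, p i` lies in block `block p
a + r`. -/
theorem block_of_add_eq_add {p : Fin r → ℕ} {t : ℕ} (hr : 1 ≤ r) (ht : IsPeriod p t)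
    {a b : Fin (∑ i, p i)} (h : (a : ℕ) + ∑ i, p i = b + partialSize p t) :
    (block p a : ℕ) + r = block p b + t := by
  have htr : t ≤ r := Nat.le_of_dvd hr ht.2.1
  have hper := ht.periodic_periodicExt hr
  have hself := prefixSize_self hr p
  rw [← prefixSize_eq_partialSize hr p htr] at h
  obtain ⟨ha, ha'⟩ := prefixSize_block hr p a
  obtain ⟨hb, hb'⟩ := prefixSize_block hr p b
  refine eq_of_prefixSize_le_lt (p := p) (a := a + prefixSize hr p r) hr ?_ ?_ ?_ ?_
  · rw [prefixSize_add hr (periodic_self hr p)]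
    omega
  · rw [add_right_comm, prefixSize_add hr (periodic_self hr p)]
    omega
  · rw [prefixSize_add hr hper]
    omega
  · rw [add_right_comm, prefixSize_add hr hper]
    omega

end Block

end HereditaryOrder

namespace HereditaryOrder

/-! ### The standard order and the shifts by `ϱ` and `w` -/

section Standard

open Matrix

variable {R F : Type*} [CommRing R] [DivisionRing F] [Algebra R F]
  {O : Subalgebra R F} {w : F} {ν : F → ℤ} {r : ℕ}

/-- Block indices differ by less than `r`, so the inequality on `r * ν (x a b)` means `ν ≥ 1`
strictly above the diagonal blocks and `ν ≥ 0` elsewhere. -/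
theorem mem_standardOrder_iff (hν : IsNormalizedVal O w ν) (p : Fin r → ℕ)
    (x : Matrix (Fin (∑ i, p i)) (Fin (∑ i, p i)) F) :
    x ∈ standardOrder O p ↔ IsBlockIntegral ν (block p) x := by
  have hdef : x ∈ standardOrder O p ↔
      (∀ a b, x a b ∈ O) ∧ ∀ a b, block p a < block p b → x a b ∈ rad O := Iff.rfl
  rw [hdef]
  constructor
  · rintro ⟨h1, h2⟩ a b hab
    have ha := (block p a).2
    have hb := (block p b).2
    have h3 := (hν.mem_iff _ hab).1 (h1 a b)
    by_cases hlt : block p a < block p b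
    · have h4 := (hν.mem_rad_iff _ hab).1 (h2 a b hlt)
      nlinarith
    · have hle : (block p b : ℕ) ≤ block p a := not_lt.1 hlt
      have : (0 : ℤ) ≤ r * ν (x a b) := mul_nonneg (by positivity) h3
      omega
  · intro h
    refine ⟨fun a b => ?_, fun a b hlt => ?_⟩
    · by_cases hab : x a b = 0
      · rw [hab]
        exact zero_mem _
      rw [hν.mem_iff _ hab]
      by_contra! hneg
      have ha := (block p a).2
      have := h a b hab
      nlinarith
    · by_cases hab : x a b = 0
      · rw [hab]
        exact zero_mem _
      rw [hν.mem_rad_iff _ hab]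
      by_contra! hneg
      have hlt' : (block p a : ℕ) < block p b := hlt
      have := h a b hab
      nlinarith

theorem isShift_zpow_smul_one (hν : IsNormalizedVal O w ν) {ι : Type*} [Fintype ι] [DecidableEq ι]
    (β : ι → Fin r) (m : ℤ) : IsShift ν β (w ^ m • (1 : Matrix ι ι F)) (r * m) := by
  intro j v
  have hz : w ^ m ≠ 0 := zpow_ne_zero m hν.uniformizer_ne_zero
  have hv : ∀ b, (v ᵥ* (w ^ m • (1 : Matrix ι ι F))) b = v b * w ^ m := by
    intro b
    rw [smul_one_eq_diagonal, vecMul_diagonal]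
  refine forall_congr' fun b => ?_
  rw [hv, mul_ne_zero_iff_right hz]
  refine forall_congr' fun hb => ?_
  rw [hν.map_mul _ _ hb hz, hν.map_zpow, mul_add]
  constructor <;> intro h <;> omega

theorem partialSize_le (p : Fin r → ℕ) (t : ℕ) : partialSize p t ≤ ∑ i, p i :=
  Finset.sum_le_sum_of_subset (Finset.filter_subset _ _)

/-- Each coordinate moves to a block index lower by `t`, or, when it wraps around, higher by `r - t`
while `ν` grows by `1`. Either way `r * ν - block` grows by `t`. -/
theorem isShift_rotation (hν : IsNormalizedVal O w ν) {p : Fin r → ℕ} {t : ℕ} (hr : 1 ≤ r)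
    (ht : IsPeriod p t) :
    IsShift ν (block p) (rotation (∑ i, p i) (partialSize p t) w) t := by
  intro j v
  have hw0 := hν.uniformizer_ne_zero
  have hq := partialSize_le p t
  have key₁ : ∀ a b : Fin (∑ i, p i), (a : ℕ) = b + partialSize p t →
      (v ᵥ* rotation (∑ i, p i) (partialSize p t) w) b = v a := by
    intro a b hab
    rw [vecMul, dotProduct, Finset.sum_eq_single a]
    · simp [rotation, hab]
    · intro c _ hc
      have hc' : (c : ℕ) ≠ a := fun h => hc (Fin.ext h)
      have := a.2
      rw [rotation, of_apply, if_neg (by omega), if_neg (by omega), mul_zero]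
    · simp
  have key₂ : ∀ a b : Fin (∑ i, p i), (a : ℕ) + ∑ i, p i = b + partialSize p t →
      (v ᵥ* rotation (∑ i, p i) (partialSize p t) w) b = v a * w := by
    intro a b hab
    rw [vecMul, dotProduct, Finset.sum_eq_single a]
    · have := a.2
      rw [rotation, of_apply, if_neg (by omega), if_pos hab]
    · intro c _ hc
      have hc' : (c : ℕ) ≠ a := fun h => hc (Fin.ext h)
      have := c.2
      rw [rotation, of_apply, if_neg (by omega), if_neg (by omega), mul_zero]
    · simp
  constructor
  · intro h b hb
    by_cases hlt : (b : ℕ) + partialSize p t < ∑ i, p i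
    · have hab : (⟨_, hlt⟩ : Fin (∑ i, p i)).1 = b + partialSize p t := rfl
      have hbl := block_of_eq_add hr ht hab
      rw [key₁ _ _ hab] at hb ⊢
      have := h _ hb
      omega
    · have hb2 := b.2
      have hlt' : (b : ℕ) + partialSize p t - ∑ i, p i < ∑ i, p i := by omega
      have hab : (⟨_, hlt'⟩ : Fin (∑ i, p i)).1 + ∑ i, p i = b + partialSize p t := by
        simp only
        omega
      have hbl := block_of_add_eq_add hr ht hab
      rw [key₂ _ _ hab] at hb ⊢
      have hva := left_ne_zero_of_mul hb
      have := h _ hva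
      rw [hν.map_mul _ _ hva hw0, hν.map_uniformizer, mul_add, mul_one]
      omega
  · intro h a ha
    by_cases hle : partialSize p t ≤ (a : ℕ)
    · have hlt : (a : ℕ) - partialSize p t < ∑ i, p i := by omega
      have hab : (a : ℕ) = (⟨_, hlt⟩ : Fin (∑ i, p i)).1 + partialSize p t := by
        simp only
        omega
      have hbl := block_of_eq_add hr ht hab
      have := h ⟨_, hlt⟩ (by rwa [key₁ _ _ hab])
      rw [key₁ _ _ hab] at this
      omega
    · have hlt : (a : ℕ) + ∑ i, p i - partialSize p t < ∑ i, p i := by omega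
      have hab : (a : ℕ) + ∑ i, p i = (⟨_, hlt⟩ : Fin (∑ i, p i)).1 + partialSize p t := by
        simp only
        omega
      have hbl := block_of_add_eq_add hr ht hab
      have := h ⟨_, hlt⟩ (by rw [key₂ _ _ hab]; exact mul_ne_zero ha hw0)
      rw [key₂ _ _ hab, hν.map_mul _ _ ha hw0, hν.map_uniformizer, mul_add, mul_one] at this
      omega

/-- If some invertible matrix shifts the chain by `c`, then the block sizes are invariant under
translation by `c`. -/
theorem IsShift.periodic_periodicExt {p : Fin r → ℕ} (hr : 1 ≤ r)
    {x : (Matrix (Fin (∑ i, p i)) (Fin (∑ i, p i)) F)ˣ} {c : ℤ}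
    (hx : IsShift ν (block p) (x : Matrix (Fin (∑ i, p i)) (Fin (∑ i, p i)) F) c) :
    Function.Periodic (periodicExt hr p) c := by
  intro z
  have h1 := residueIndex_modEq hr (z + c)
  have h2 := residueIndex_modEq hr z
  apply le_antisymm
  · have := hx.card_fiber_le (i := residueIndex hr (z + c)) (i' := residueIndex hr z)
      (h2.trans (by simpa using (h1.sub_right c).symm))
    rwa [card_block_fiber, card_block_fiber] at this
  · have := hx.units_inv.card_fiber_le (i := residueIndex hr z) (i' := residueIndex hr (z + c))
      (h1.trans (by simpa using (h2.add_right c).symm))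
    rwa [card_block_fiber, card_block_fiber] at this

end Standard

end HereditaryOrder

/-! ### The normal form -/

theorem theoremT {R K F : Type*}
    [CommRing R] [IsDomain R] [IsDiscreteValuationRing R]
    [IsAdicComplete (IsLocalRing.maximalIdeal R) R]
    [Field K] [Algebra R K] [IsFractionRing R K]
    [DivisionRing F] [Algebra K F] [FiniteDimensional K F]
    [Algebra R F] [IsScalarTower R K F]
    (O : Subalgebra R F) (hO : HereditaryOrder.IsMaximalOrderIn R K O)
    (w : F) (hw : HereditaryOrder.IsRadGenerator O w)
    {r : ℕ} (hr : 1 ≤ r) (p : Fin r → ℕ) (hp : ∀ i, 1 ≤ p i)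
    (t l : ℕ) (ht : IsLeast {s | HereditaryOrder.IsPeriod p s} t) (hl : r = l * t)
    (x : HereditaryOrder.normalizer (HereditaryOrder.standardOrder O p)) :
    ∃ (d : ℤ) (k : ℕ) (y : HereditaryOrder.normalizer (HereditaryOrder.standardOrder O p)),
      k < l ∧
      ((y : (Matrix (Fin (∑ i, p i)) (Fin (∑ i, p i)) F)ˣ) :
          Matrix (Fin (∑ i, p i)) (Fin (∑ i, p i)) F) =
        w ^ (-d) •
          HereditaryOrder.rotation (∑ i, p i) (HereditaryOrder.partialSize p t) w ^ k ∧
      HereditaryOrder.Equivalent (HereditaryOrder.standardOrder O p) x y := by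
  have hord := hO.prop
  have : IsNoetherian R O := HereditaryOrder.isNoetherian_of_fg hord.fg
  have hloc := HereditaryOrder.isUnitOf_or_isUnitOf_one_sub hord.fg
  have hw0 := hw.ne_zero hloc (HereditaryOrder.exists_mem_not_isUnitOf K hord.fg)
  have hden : ∀ a : F, ∃ s ∈ O, s ≠ 0 ∧ s * a ∈ O := by
    intro a
    obtain ⟨s, hs, hsa⟩ := HereditaryOrder.exists_algebraMap_mul_mem hord.span_eq_top a
    refine ⟨algebraMap R F s, O.algebraMap_mem s, ?_, hsa⟩
    rw [IsScalarTower.algebraMap_apply R K F]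
    simpa using hs
  obtain ⟨ν, hν⟩ := hw.exists_isNormalizedVal hw0 hloc hden
  have hH := HereditaryOrder.mem_standardOrder_iff hν p
  obtain ⟨c, hc⟩ := HereditaryOrder.exists_isShift_of_mem_normalizer hr hν
    (HereditaryOrder.block_surjective hp) hH x.2
  obtain ⟨m, hm⟩ := HereditaryOrder.natCast_dvd_of_isLeast_of_periodic ht hr (hc.periodic_periodicExt hr)
  have hl0 : 0 < l := Nat.pos_of_ne_zero (by rintro rfl; omega)
  have hl' : (0 : ℤ) < l := by exact_mod_cast hl0
  have hmod := Int.emod_nonneg m hl'.ne'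
  have hmlt := Int.emod_lt_of_pos m hl'
  have hdiv := Int.mul_ediv_add_emod m l
  -- Since `c = t * m` and `r = l * t`, dividing `m` by `l` gives the exponents: the quotient for
  -- `w`, the remainder for `ϱ`.
  have hshift := (HereditaryOrder.isShift_zpow_smul_one hν (HereditaryOrder.block p) (m / l)).mul
    ((HereditaryOrder.isShift_rotation hν hr ht.1).pow (m % l).toNat)
  rw [smul_one_mul, Int.toNat_of_nonneg hmod] at hshift
  have hcd : (r * (m / l) + m % l * t : ℤ) = c := by
    have hrl : (r : ℤ) = l * t := by exact_mod_cast hl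
    rw [hm, hrl]
    linear_combination (t : ℤ) * hdiv
  rw [hcd] at hshift
  obtain ⟨y, hy⟩ := hshift.isUnit
  have hyc : HereditaryOrder.IsShift ν (HereditaryOrder.block p)
      (y : Matrix (Fin (∑ i, p i)) (Fin (∑ i, p i)) F) c := hy ▸ hshift
  refine ⟨-(m / l), (m % l).toNat, ⟨y, hyc.mem_normalizer hν hH⟩, by omega, ?_, ?_⟩
  · rw [neg_neg]
    exact hy
  · have h1 := hyc.mul hc.units_inv
    have h2 := hc.mul hyc.units_inv
    rw [add_neg_cancel] at h1 h2
    -- The unit `g` is `y x⁻¹`, with inverse `x y⁻¹`, and `h = 1`.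
    refine ⟨⟨⟨_, (hH _).2 (h1.isBlockIntegral hν)⟩, ⟨_, (hH _).2 (h2.isBlockIntegral hν)⟩,
      Subtype.ext ?_, Subtype.ext ?_⟩, 1, ?_⟩
    · simp [mul_assoc]
    · simp [mul_assoc]
    · simp [mul_assoc]
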